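/- Let $d\ge 1$ and let $f\in BV(\mathbb R^d)\cap L^\infty(\mathbb R^d)$ be real-valued with compact (essential) support; here $BV(\mathbb R^d)$ is the set of $f\in L^1(\mathbb R^d)$ with $$[f]_{BV}=\sup\Big\{\int_{\mathbb R^d} f\,\operatorname{div}\phi\,dx:\ \phi\in C_c^\infty(\mathbb R^d;\mathbb R^d),\ |\phi|\le 1\Big\}<\infty .$$ Let $\varrho_L:(0,\infty)\to[0,\infty)$, for real $L>L_0$, be measurable functions such that for every $R>0$: (a) $\displaystyle\lim_{L\to\infty}\int_{|x|>R}\frac{\varrho_L(|x|)}{|x|}\,dx=0$; (b) $\displaystyle\lim_{L\to\infty}\int_{|x|<R}\varrho_L(|x|)\,dx=1$; (c) there is a constant $C_R>0$, independent of $L$, such that $\varrho_L(t)\le C_R\,t^{-d}$ for all $t>R$ and all $L>L_0$. (The $\varrho_L(|\cdot|)$ need not be integrable on $\mathbb R^d$.) Then $$\lim_{L\to\infty}\iint_{\mathbb R^d\times\mathbb R^d}\frac{|f(x)-f(y)|}{|x-y|}\,\varrho_L(|x-y|)\,dx\,dy=K_d\,[f]_{BV},$$ where, for any unit vector $e\in\mathbb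 R^d$ and with $\sigma$ the surface measure on the unit sphere $\mathbb S^{d-1}$, $$K_d=\frac1{\sigma(\mathbb S^{d-1})}\int_{\mathbb S^{d-1}}|\langle e,\xi\rangle|\,d\sigma(\xi)=\frac{\Gamma(d/2)}{\sqrt\pi\,\Gamma((d+1)/2)} .$$ All integrals of nonnegative functions are taken in $[0,\infty]$. -/

import Mathlib

open MeasureTheory Filter Topology Set
open scoped ENNReal ContDiff

noncomputable section

/-- The divergence of a vector field on `ℝ^d`. -/
def divergence {d : ℕ} (φ : EuclideanSpace ℝ (Fin d) → EuclideanSpace ℝ (Fin d))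
    (x : EuclideanSpace ℝ (Fin d)) : ℝ :=
  ∑ i : Fin d, (fderiv ℝ φ x (EuclideanSpace.single i 1)) i

/-- The total variation `[f]_BV = |Df|(ℝ^d)`: the supremum of `∫ f div φ` over the smooth compactly
supported vector fields `φ` with `|φ| ≤ 1` everywhere, as an element of `[0, ∞]`. (The field `φ = 0`
is admissible, so that cutting off the negative values does not change the supremum.) -/
def totalVariation {d : ℕ} (f : EuclideanSpace ℝ (Fin d) → ℝ) : ℝ≥0∞ :=
  ⨆ (φ : EuclideanSpace ℝ (Fin d) → EuclideanSpace ℝ (Fin d))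
    (_ : ContDiff ℝ ∞ φ ∧ HasCompactSupport φ ∧ ∀ x, ‖φ x‖ ≤ 1),
    ENNReal.ofReal (∫ x, f x * divergence φ x)

/-- `f ∈ BV(ℝ^d)`: integrable, with finite total variation. -/
def MemBV {d : ℕ} (f : EuclideanSpace ℝ (Fin d) → ℝ) : Prop :=
  Integrable f ∧ totalVariation f < ⊤

/-- The mean of `ξ ↦ |⟨e, ξ⟩|` over the unit sphere with respect to surface measure; for a unit
vector `e` this is the constant `K_d`. -/
def sphereMean {d : ℕ} (e : EuclideanSpace ℝ (Fin d)) : ℝ :=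
  ⨍ ξ : Metric.sphere (0 : EuclideanSpace ℝ (Fin d)) 1,
    |inner ℝ e (ξ : EuclideanSpace ℝ (Fin d))|
      ∂((volume : Measure (EuclideanSpace ℝ (Fin d))).toSphere)

end

/-! Substituting y = x + h turns the double integral into ∫ ϱ_L(|h|) |h|⁻¹ D(h) dh, where D(h) is
the L¹ distance between f and its translate by h. In polar coordinates only the spherical means S(r)
= r⁻¹ ∫ D(rξ) dσ(ξ) meet the kernel, and two facts about them suffice, with T = K_d [f]_BV: S(r) ≤
σ(𝕊) T for every r > 0, and liminf S(r) ≥ σ(𝕊) T as r → 0.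

For smooth u, the fundamental theorem of calculus gives D(h) ≤ ∫ |∂_h u|, and Fatou applied to the
difference quotients gives the matching lower bound. Averaging |⟨∇u(x), ξ⟩| over the sphere produces
K_d |∇u(x)|, and ∫ |∇u| is compared with the total variation by duality. Mollification carries both
facts over to f: it increases neither D nor the total variation, Fatou recovers D from the
mollifications, and the total variation is at most the supremum of theirs
(`lintegral_toSphere_translationDefect_le`, `le_liminf_lintegral_toSphere_translationDefect`).

By (b), the kernel has asymptotic mass 1 on every ball. A small ball therefore gives the lower
bound. For the upper bound the unit ball contributes at most T in the limit, and the rest vanishes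
by (a), because D ≤ 2‖f‖₁. The value of K_d comes from computing Gaussian integrals both in polar
and in Cartesian coordinates. -/

open MeasureTheory Filter Topology Set
open scoped ENNReal ContDiff

/-! ### Polar coordinates -/

section Polar

variable {E : Type*} [NormedAddCommGroup E] [NormedSpace ℝ E] [MeasurableSpace E] [BorelSpace E]
  [FiniteDimensional ℝ E] (μ : Measure E) [μ.IsAddHaarMeasure]

/-- Integration in polar coordinates for functions with values in `[0, ∞]`. -/
theorem lintegral_eq_lintegral_Ioi_lintegral_sphere [Nontrivial E] {F : E → ℝ≥0∞}
    (hF : Measurable F) :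
    ∫⁻ x, F x ∂μ = ∫⁻ r : Ioi (0 : ℝ), ∫⁻ ξ, F (r.1 • (ξ : E)) ∂μ.toSphere
      ∂Measure.volumeIoiPow (Module.finrank ℝ E - 1) := by
  have h1 : ∫⁻ x, F x ∂μ = ∫⁻ x : ({(0)}ᶜ : Set E), F x.1 ∂(μ.comap (↑)) := by
    rw [lintegral_subtype_comap (measurableSet_singleton _).compl, restrict_compl_singleton]
  rw [h1, ← lintegral_prod_symm
      (fun p : Metric.sphere (0 : E) 1 × Ioi (0 : ℝ) => F (p.2.1 • (p.1 : E)))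
      (Measurable.aemeasurable (by fun_prop)),
    ← μ.measurePreserving_homeomorphUnitSphereProd.lintegral_comp_emb
      (Homeomorph.measurableEmbedding _)]
  refine lintegral_congr fun x => ?_
  have hx : ‖(x : E)‖ ≠ 0 := norm_ne_zero_iff.2 x.2
  simp [smul_smul, hx]

/-- Integration in polar coordinates of a product of a radial and an angular function. -/
theorem integral_angular_mul_radial [Nontrivial E] (A : E → ℝ) (B : ℝ → ℝ) :
    ∫ x, A (‖x‖⁻¹ • x) * B ‖x‖ ∂μ =
      (∫ ξ, A (ξ : E) ∂μ.toSphere) *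
        ∫ r in Ioi (0 : ℝ), r ^ (Module.finrank ℝ E - 1) * B r := by
  calc
    ∫ x, A (‖x‖⁻¹ • x) * B ‖x‖ ∂μ
        = ∫ x : ({(0)}ᶜ : Set E), A (‖x.1‖⁻¹ • x.1) * B ‖x.1‖ ∂(μ.comap (↑)) := by
      rw [integral_subtype_comap (measurableSet_singleton _).compl
        fun x : E ↦ A (‖x‖⁻¹ • x) * B ‖x‖, restrict_compl_singleton]
    _ = ∫ x, A (x.1 : E) * B x.2 ∂μ.toSphere.prod (.volumeIoiPow (Module.finrank ℝ E - 1)) := by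
      simpa using μ.measurePreserving_homeomorphUnitSphereProd.integral_comp
        (Homeomorph.measurableEmbedding _)
        (fun p : Metric.sphere (0 : E) 1 × Ioi (0 : ℝ) => A (p.1 : E) * B p.2)
    _ = (∫ ξ, A (ξ : E) ∂μ.toSphere) *
        ∫ r : Ioi (0 : ℝ), B r ∂.volumeIoiPow (Module.finrank ℝ E - 1) :=
      integral_prod_mul (fun ξ : Metric.sphere (0 : E) 1 => A ξ) (fun r : Ioi (0 : ℝ) => B r)
    _ = _ := by
      congr 1
      simp only [Measure.volumeIoiPow, ENNReal.ofReal]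
      rw [integral_withDensity_eq_integral_smul,
        integral_subtype_comap measurableSet_Ioi
          fun a ↦ Real.toNNReal (a ^ (Module.finrank ℝ E - 1)) • B a,
        setIntegral_congr_fun measurableSet_Ioi fun x hx ↦ ?_]
      · rw [NNReal.smul_def, Real.coe_toNNReal _ (pow_nonneg hx.out.le _), smul_eq_mul]
      · exact (measurable_subtype_coe.pow_const _).real_toNNReal

/-- Almost everywhere properties on the half line hold almost everywhere for the norm. -/
theorem ae_norm_of_ae_Ioi [Nontrivial E] {p : ℝ → Prop}
    (hp : ∀ᵐ r ∂(volume.restrict (Ioi (0 : ℝ))), p r) : ∀ᵐ x ∂μ, p ‖x‖ := by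
  obtain ⟨N, hN, hNm, hN0⟩ := exists_measurable_superset_of_null hp
  have hA : MeasurableSet ((fun x : E => ‖x‖) ⁻¹' N) := hNm.preimage measurable_norm
  refine measure_mono_null (t := (fun x : E => ‖x‖) ⁻¹' N) (fun x hx => hN hx) ?_
  -- In polar coordinates the measure of the preimage of `N` is a radial integral whose integrand
  -- vanishes for r outside `N`, and `N` is null for the density r^(n-1) dr as well.
  rw [← lintegral_indicator_one hA,
    lintegral_eq_lintegral_Ioi_lintegral_sphere μ (measurable_one.indicator hA)]
  have h0 : ∀ᵐ r : Ioi (0 : ℝ) ∂Measure.volumeIoiPow (Module.finrank ℝ E - 1), r.1 ∉ N := by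
    refine (withDensity_absolutelyContinuous _ _).ae_le ?_
    refine mem_ae_iff.2 ?_
    simp only [compl_ofPred, not_not]
    change Measure.comap Subtype.val volume (Subtype.val ⁻¹' N : Set (Ioi (0 : ℝ))) = 0
    rw [comap_subtype_coe_apply measurableSet_Ioi, Subtype.image_preimage_coe, inter_comm,
      ← Measure.restrict_apply hNm, hN0]
  rw [lintegral_congr_ae (g := 0)]
  · simp
  · filter_upwards [h0] with r hr
    have hr0 : 0 < r.1 := r.2
    simp [indicator, norm_smul, abs_of_pos hr0, hr]

end Polar

/-! ### The constant K_d via Gaussian integrals -/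

section SphereConstant

variable {d : ℕ}

theorem integral_abs_mul_exp_neg_sq : ∫ t : ℝ, |t| * Real.exp (-t ^ 2) = 1 := by
  have h := integral_comp_abs (f := fun t : ℝ => t * Real.exp (-t ^ 2))
  simp only [sq_abs] at h
  rw [h]
  have := integral_rpow_mul_exp_neg_rpow (p := 2) (q := 1) (by norm_num) (by norm_num)
  norm_num at this
  rw [this]; norm_num

theorem integral_pow_mul_exp_neg_sq (n : ℕ) :
    ∫ r in Ioi (0 : ℝ), r ^ n * Real.exp (-r ^ 2) = Real.Gamma (((n : ℝ) + 1) / 2) / 2 := by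
  have := integral_rpow_mul_exp_neg_rpow (p := 2) (q := n) (by norm_num)
    (by have : (0 : ℝ) ≤ n := n.cast_nonneg
        linarith)
  simp only [Real.rpow_natCast] at this
  norm_num at this
  rw [this]; ring

/-- The integrand is a product over the coordinates: the `i`-th factor integrates to 1, every other
one to √π. -/
theorem integral_abs_apply_mul_exp_neg_norm_sq (i : Fin d) :
    ∫ x : EuclideanSpace ℝ (Fin d), |x i| * Real.exp (-‖x‖ ^ 2) = √Real.pi ^ (d - 1) := by
  have h := (EuclideanSpace.volume_preserving_symm_measurableEquiv_toLp (Fin d)).symm.integral_comp'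
    (g := fun x : EuclideanSpace ℝ (Fin d) => |x i| * Real.exp (-‖x‖ ^ 2))
  rw [← h]
  have h2 : ∀ x : Fin d → ℝ, |x i| * Real.exp (-∑ j, x j ^ 2)
      = ∏ j, (if j = i then |x j| else 1) * Real.exp (-x j ^ 2) := by
    intro x
    rw [Finset.prod_mul_distrib, ← Real.exp_sum, Finset.sum_neg_distrib]
    simp
  simp [EuclideanSpace.norm_sq_eq]
  simp_rw [h2]
  rw [integral_fintype_prod_volume_eq_prod
    (fun j (t : ℝ) => (if j = i then |t| else 1) * Real.exp (-t ^ 2))]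
  have h3 : ∀ j, ∫ t : ℝ, (if j = i then |t| else 1) * Real.exp (-t ^ 2)
      = if j = i then 1 else √Real.pi := by
    intro j
    split_ifs
    · exact integral_abs_mul_exp_neg_sq
    · simpa using integral_gaussian 1
  simp_rw [h3]
  rw [Finset.prod_ite]
  simp [Finset.filter_ne', Finset.card_erase_of_mem]

theorem integral_exp_neg_norm_sq :
    ∫ x : EuclideanSpace ℝ (Fin d), Real.exp (-‖x‖ ^ 2) = √Real.pi ^ d := by
  have h := GaussianFourier.integral_rexp_neg_mul_sq_norm (V := EuclideanSpace ℝ (Fin d)) one_pos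
  simp only [neg_mul, one_mul, div_one, finrank_euclideanSpace, Fintype.card_fin] at h
  rw [h, Real.sqrt_eq_rpow, ← Real.rpow_natCast, ← Real.rpow_mul Real.pi_pos.le]
  congr 1; ring

theorem integral_abs_inner_mul_exp_neg_norm_sq (hd : 1 ≤ d) (v : EuclideanSpace ℝ (Fin d)) :
    ∫ x, |inner ℝ v x| * Real.exp (-‖x‖ ^ 2) = ‖v‖ * √Real.pi ^ (d - 1) := by
  -- A reflection takes `v` to a vector of the same length on the first axis, which reduces the
  -- integral to the coordinate case.
  let w : EuclideanSpace ℝ (Fin d) := ‖v‖ • EuclideanSpace.single ⟨0, hd⟩ 1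
  have hvw : ‖v‖ = ‖w‖ := by simp [w, norm_smul]
  let Φ := (ℝ ∙ (v - w))ᗮ.reflection
  have hΦ : Φ v = w := Submodule.reflection_sub hvw
  have h := Φ.measurePreserving.integral_comp Φ.toHomeomorph.measurableEmbedding
    (fun x => |inner ℝ w x| * Real.exp (-‖x‖ ^ 2))
  rw [← hΦ] at h
  simp only [LinearIsometryEquiv.inner_map_map, LinearIsometryEquiv.norm_map] at h
  rw [h, hΦ, ← integral_abs_apply_mul_exp_neg_norm_sq ⟨0, hd⟩, ← integral_const_mul]
  refine integral_congr_ae (.of_forall fun x => ?_)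
  simp [w, inner_smul_left, EuclideanSpace.inner_single_left, abs_mul, mul_assoc]

/-- Since |⟨v, x⟩| is ‖x‖ times its value in the direction of x, the Gaussian integral of |⟨v, x⟩|
splits into the spherical integral and the radial integral of r^(d-1) · r · exp(-r²). -/
theorem integral_toSphere_abs_inner (hd : 1 ≤ d) (v : EuclideanSpace ℝ (Fin d)) :
    (∫ ξ : Metric.sphere (0 : EuclideanSpace ℝ (Fin d)) 1,
      |inner ℝ v (ξ : EuclideanSpace ℝ (Fin d))| ∂(volume : Measure _).toSphere) *
      (Real.Gamma (((d : ℝ) + 1) / 2) / 2) = ‖v‖ * √Real.pi ^ (d - 1) := by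
  have : Nonempty (Fin d) := ⟨⟨0, hd⟩⟩
  have h := integral_angular_mul_radial (volume : Measure (EuclideanSpace ℝ (Fin d)))
    (fun x => |inner ℝ v x|) (fun r => r * Real.exp (-r ^ 2))
  rw [← integral_pow_mul_exp_neg_sq, ← integral_abs_inner_mul_exp_neg_norm_sq hd]
  simp only [finrank_euclideanSpace, Fintype.card_fin, ← mul_assoc, ← pow_succ,
    Nat.sub_add_cancel hd] at h
  rw [← h]
  refine integral_congr_ae (.of_forall fun x => ?_)
  rcases eq_or_ne x 0 with rfl | hx
  · simp
  · have : ‖x‖ ≠ 0 := norm_ne_zero_iff.2 hx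
    simp only [inner_smul_right, abs_mul, abs_inv, abs_norm]
    field_simp

theorem toSphere_real_univ_mul_Gamma (hd : 1 ≤ d) :
    (volume : Measure (EuclideanSpace ℝ (Fin d))).toSphere.real univ *
      (Real.Gamma ((d : ℝ) / 2) / 2) = √Real.pi ^ d := by
  have : Nonempty (Fin d) := ⟨⟨0, hd⟩⟩
  have h := integral_angular_mul_radial (volume : Measure (EuclideanSpace ℝ (Fin d)))
    (fun _ => 1) (fun r => Real.exp (-r ^ 2))
  simp only [finrank_euclideanSpace, Fintype.card_fin, one_mul, integral_exp_neg_norm_sq,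
    integral_pow_mul_exp_neg_sq, Nat.cast_sub hd] at h
  simpa using h.symm

theorem sphereMean_eq_Gamma_div (hd : 1 ≤ d) {e : EuclideanSpace ℝ (Fin d)} (he : ‖e‖ = 1) :
    sphereMean e =
      Real.Gamma ((d : ℝ) / 2) / (√Real.pi * Real.Gamma (((d : ℝ) + 1) / 2)) := by
  have hd0 : (0 : ℝ) < d := by exact_mod_cast hd
  have h1 := integral_toSphere_abs_inner hd e
  have h2 := toSphere_real_univ_mul_Gamma hd
  have g1 : 0 < Real.Gamma ((d : ℝ) / 2) := Real.Gamma_pos_of_pos (by positivity)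
  have g2 : 0 < Real.Gamma (((d : ℝ) + 1) / 2) := Real.Gamma_pos_of_pos (by positivity)
  have hπ : 0 < √Real.pi := Real.sqrt_pos.2 Real.pi_pos
  rw [he, one_mul] at h1
  obtain ⟨n, rfl⟩ : ∃ n, d = n + 1 := ⟨d - 1, by omega⟩
  rw [sphereMean, average_eq, smul_eq_mul]
  set I := ∫ ξ : Metric.sphere (0 : EuclideanSpace ℝ (Fin (n + 1))) 1,
      |inner ℝ e (ξ : EuclideanSpace ℝ (Fin (n + 1)))| ∂(volume : Measure _).toSphere
  set s := (volume : Measure (EuclideanSpace ℝ (Fin (n + 1)))).toSphere.real univ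
  have hs : s ≠ 0 := by
    intro h
    rw [h, zero_mul] at h2
    exact (pow_pos hπ _).ne h2
  rw [Nat.add_sub_cancel] at h1
  rw [pow_succ, ← h1] at h2
  field_simp at h2 ⊢
  linarith

/-- The spherical mean of `|⟨v, ξ⟩|` is `‖v‖` times the one of a unit vector. -/
theorem lintegral_toSphere_abs_inner (hd : 1 ≤ d) {e : EuclideanSpace ℝ (Fin d)} (he : ‖e‖ = 1)
    (v : EuclideanSpace ℝ (Fin d)) :
    ∫⁻ ξ : Metric.sphere (0 : EuclideanSpace ℝ (Fin d)) 1,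
      ‖inner ℝ v (ξ : EuclideanSpace ℝ (Fin d))‖ₑ ∂(volume : Measure _).toSphere =
    ‖v‖ₑ * (ENNReal.ofReal (sphereMean e) *
      (volume : Measure (EuclideanSpace ℝ (Fin d))).toSphere univ) := by
  have : Nonempty (Fin d) := ⟨⟨0, hd⟩⟩
  have hd0 : (0 : ℝ) < d := by exact_mod_cast hd
  have g2 : 0 < Real.Gamma (((d : ℝ) + 1) / 2) := Real.Gamma_pos_of_pos (by positivity)
  have h1 := integral_toSphere_abs_inner hd e
  have h2 := integral_toSphere_abs_inner hd v
  have hs : (volume : Measure (EuclideanSpace ℝ (Fin d))).toSphere.real univ ≠ 0 := by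
    simp [measureReal_def, ENNReal.toReal_eq_zero_iff, -Measure.toSphere_apply_univ]
  rw [he, one_mul] at h1
  rw [← h1, ← mul_assoc] at h2
  have h3 := mul_right_cancel₀ (by positivity) h2
  have hint : ∀ w : EuclideanSpace ℝ (Fin d),
      Integrable (fun ξ : Metric.sphere (0 : EuclideanSpace ℝ (Fin d)) 1 =>
        |inner ℝ w (ξ : EuclideanSpace ℝ (Fin d))|) (volume : Measure _).toSphere := fun w =>
    Continuous.integrable_of_hasCompactSupport (by fun_prop) (HasCompactSupport.of_compactSpace _)
  simp_rw [← ofReal_norm, Real.norm_eq_abs]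
  rw [← ofReal_integral_eq_lintegral_ofReal (hint v) (.of_forall fun _ => abs_nonneg _), h3,
    ENNReal.ofReal_mul (norm_nonneg _)]
  congr 1
  rw [sphereMean, average_eq, smul_eq_mul, ← ofReal_measureReal (measure_ne_top _ _),
    ← ENNReal.ofReal_mul]
  · congr 1; field_simp
  · exact mul_nonneg (by positivity) (integral_nonneg fun _ => abs_nonneg _)

end SphereConstant

/-! ### L¹ distance to translates, and mollification -/

section TranslationDefect

open scoped Convolution

variable {E : Type*} [NormedAddCommGroup E] [MeasurableSpace E] [BorelSpace E] {μ : Measure E}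

/-- The `L¹` distance between `f` and its translate by `h`. -/
noncomputable def translationDefect (μ : Measure E) (f : E → ℝ) (h : E) : ℝ≥0∞ :=
  ∫⁻ x, ‖f (x + h) - f x‖ₑ ∂μ

theorem measurable_translationDefect [SecondCountableTopology E] [SFinite μ] {f : E → ℝ}
    (hf : Measurable f) : Measurable (translationDefect μ f) := by
  unfold translationDefect
  exact Measurable.lintegral_prod_right (f := fun h x => ‖f (x + h) - f x‖ₑ) (by fun_prop)

theorem translationDefect_le [μ.IsAddRightInvariant] (f : E → ℝ) (hf : Measurable f) (h : E) :
    translationDefect μ f h ≤ 2 * ∫⁻ x, ‖f x‖ₑ ∂μ := by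
  calc translationDefect μ f h ≤ ∫⁻ x, (‖f (x + h)‖ₑ + ‖f x‖ₑ) ∂μ :=
        lintegral_mono fun x => enorm_sub_le
    _ = 2 * ∫⁻ x, ‖f x‖ₑ ∂μ := by
      rw [lintegral_add_right _ (by fun_prop), lintegral_add_right_eq_self (fun x => ‖f x‖ₑ) h,
        two_mul]

variable [NormedSpace ℝ E] [FiniteDimensional ℝ E]

theorem continuous_integral_mul_comp_sub {f ψ : E → ℝ}
    (hfi : Integrable f μ) (hψ : Continuous ψ) {C : ℝ} (hC : ∀ x, ‖ψ x‖ ≤ C) :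
    Continuous fun s => ∫ x, f x * ψ (x - s) ∂μ := by
  refine continuous_of_dominated (bound := fun x => ‖f x‖ * C) (fun s => ?_) (fun s => ?_)
    (hfi.norm.mul_const C) (.of_forall fun x => by fun_prop)
  · exact hfi.aestronglyMeasurable.mul (by fun_prop)
  · refine .of_forall fun x => ?_
    rw [norm_mul]
    exact mul_le_mul_of_nonneg_left (hC _) (norm_nonneg _)

variable [μ.IsAddHaarMeasure]

/-- Mollification does not increase the `L¹` distance to translates. -/
theorem translationDefect_convolution_le (η : ContDiffBump (0 : E)) {f : E → ℝ}
    (hf : Measurable f) (hfi : Integrable f μ) (h : E) :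
    translationDefect μ (η.normed μ ⋆[ContinuousLinearMap.lsmul ℝ ℝ, μ] f) h
      ≤ translationDefect μ f h := by
  have hex : ConvolutionExists (η.normed μ) f (ContinuousLinearMap.lsmul ℝ ℝ) μ :=
    η.hasCompactSupport_normed.convolutionExists_left _ η.continuous_normed hfi.locallyIntegrable
  have hη : Measurable (η.normed μ) := η.continuous_normed.measurable
  have hpt : ∀ x, ‖(η.normed μ ⋆[ContinuousLinearMap.lsmul ℝ ℝ, μ] f) (x + h)
      - (η.normed μ ⋆[ContinuousLinearMap.lsmul ℝ ℝ, μ] f) x‖ₑ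
      ≤ ∫⁻ t, ‖η.normed μ t‖ₑ * ‖f (x - t + h) - f (x - t)‖ₑ ∂μ := by
    intro x
    -- The increment of the mollification is the `η`-average of increments of `f`; by translation
    -- invariance each of these has the same L¹ norm.
    rw [convolution_def, convolution_def, ← integral_sub (hex (x + h)) (hex x)]
    refine (enorm_integral_le_lintegral_enorm _).trans_eq (lintegral_congr fun t => ?_)
    simp only [ContinuousLinearMap.lsmul_apply, smul_eq_mul, ← mul_sub, enorm_mul,
      add_sub_right_comm]
  calc translationDefect μ (η.normed μ ⋆[ContinuousLinearMap.lsmul ℝ ℝ, μ] f) h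
      ≤ ∫⁻ x, ∫⁻ t, ‖η.normed μ t‖ₑ * ‖f (x - t + h) - f (x - t)‖ₑ ∂μ ∂μ := lintegral_mono hpt
    _ = ∫⁻ t, ∫⁻ x, ‖η.normed μ t‖ₑ * ‖f (x - t + h) - f (x - t)‖ₑ ∂μ ∂μ :=
      lintegral_lintegral_swap (Measurable.aemeasurable (by fun_prop))
    _ = ∫⁻ t, ‖η.normed μ t‖ₑ * translationDefect μ f h ∂μ := by
      refine lintegral_congr fun t => ?_
      rw [lintegral_const_mul _ (by fun_prop),
        lintegral_sub_right_eq_self (fun x => ‖f (x + h) - f x‖ₑ) t, translationDefect]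
    _ = translationDefect μ f h := by
      rw [lintegral_mul_const _ (by fun_prop), ← ofReal_integral_norm_eq_lintegral_enorm
        (η.continuous_normed.integrable_of_hasCompactSupport η.hasCompactSupport_normed)]
      simp_rw [Real.norm_of_nonneg (η.nonneg_normed _), η.integral_normed]
      simp

/-- The increment is the integral of the derivative along the segment from x to x + h. After
Tonelli, translation invariance makes the contribution of each point of the segment the same. -/
theorem translationDefect_le_lintegral_fderiv {u : E → ℝ} (hu : ContDiff ℝ 1 u) (h : E) :
    translationDefect μ u h ≤ ∫⁻ x, ‖fderiv ℝ u x h‖ₑ ∂μ := by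
  have hc : Continuous fun x => fderiv ℝ u x h := by
    have := hu.continuous_fderiv (by norm_num)
    fun_prop
  have hpt : ∀ x, ‖u (x + h) - u x‖ₑ ≤ ∫⁻ t in Ioc (0 : ℝ) 1, ‖fderiv ℝ u (x + t • h) h‖ₑ := by
    intro x
    have hd : ∀ t : ℝ, HasDerivAt (fun t : ℝ => u (x + t • h)) (fderiv ℝ u (x + t • h) h) t := by
      intro t
      have h1 : HasDerivAt (fun t : ℝ => x + t • h) h t := by
        simpa using ((hasDerivAt_id t).smul_const h).const_add x
      exact ((hu.differentiable (by norm_num)) _).hasFDerivAt.comp_hasDerivAt t h1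
    have := intervalIntegral.integral_eq_sub_of_hasDerivAt (a := 0) (b := 1)
      (fun t _ => hd t) (Continuous.intervalIntegrable (by fun_prop) _ _)
    simp only [one_smul, zero_smul, add_zero] at this
    rw [← this, intervalIntegral.integral_of_le zero_le_one]
    exact enorm_integral_le_lintegral_enorm _
  calc translationDefect μ u h
      ≤ ∫⁻ x, (∫⁻ t in Ioc (0 : ℝ) 1, ‖fderiv ℝ u (x + t • h) h‖ₑ) ∂μ := lintegral_mono hpt
    _ = ∫⁻ t in Ioc (0 : ℝ) 1, (∫⁻ x, ‖fderiv ℝ u (x + t • h) h‖ₑ ∂μ) :=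
      lintegral_lintegral_swap (Continuous.aemeasurable (by
        exact (hc.comp (by fun_prop : Continuous fun p : E × ℝ => p.1 + p.2 • h)).enorm))
    _ = ∫⁻ x, ‖fderiv ℝ u x h‖ₑ ∂μ := by
      simp_rw [lintegral_add_right_eq_self (fun x => ‖fderiv ℝ u x h‖ₑ)]
      simp

/-- Duality between mollification and testing against a bounded continuous function. -/
theorem integral_convolution_mul_eq (η : ContDiffBump (0 : E)) {f ψ : E → ℝ}
    (hfi : Integrable f μ) (hψ : Continuous ψ) {C : ℝ} (hC : ∀ x, ‖ψ x‖ ≤ C) :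
    ∫ x, (η.normed μ ⋆[ContinuousLinearMap.lsmul ℝ ℝ, μ] f) x * ψ x ∂μ =
      ∫ t, η.normed μ t * ∫ x, f x * ψ (x + t) ∂μ ∂μ := by
  have hηi : Integrable (η.normed μ) μ :=
    η.continuous_normed.integrable_of_hasCompactSupport η.hasCompactSupport_normed
  have hI := (hηi.convolution_integrand (ContinuousLinearMap.lsmul ℝ ℝ) hfi).mul_bdd (c := C)
    (g := fun p : E × E => ψ p.1) (by fun_prop) (.of_forall fun p => hC p.1)
  simp only [ContinuousLinearMap.lsmul_apply, smul_eq_mul] at hI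
  simp_rw [convolution_def, ← integral_mul_const]
  simp only [ContinuousLinearMap.lsmul_apply, smul_eq_mul]
  rw [integral_integral_swap (by simpa [Function.uncurry_def] using hI)]
  refine integral_congr_ae (.of_forall fun t => ?_)
  simp only [mul_assoc, integral_const_mul]
  congr 1
  rw [← integral_sub_right_eq_self (fun x => f x * ψ (x + t)) t]
  simp

/-- By duality these integrals are the mollifications, evaluated at 0, of the continuous function s
↦ ∫ f(x) ψ(x - s) dx. -/
theorem tendsto_integral_convolution_mul {η : ℕ → ContDiffBump (0 : E)}
    (hη : Tendsto (fun n => (η n).rOut) atTop (𝓝 0)) {f ψ : E → ℝ}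
    (hfi : Integrable f μ) (hψ : Continuous ψ) {C : ℝ} (hC : ∀ x, ‖ψ x‖ ≤ C) :
    Tendsto (fun n => ∫ x, ((η n).normed μ ⋆[ContinuousLinearMap.lsmul ℝ ℝ, μ] f) x * ψ x ∂μ)
      atTop (𝓝 (∫ x, f x * ψ x ∂μ)) := by
  have := ContDiffBump.convolution_tendsto_right_of_continuous (μ := μ) hη
    (continuous_integral_mul_comp_sub hfi hψ hC) 0
  simp only [sub_zero] at this
  refine this.congr fun n => ?_
  rw [integral_convolution_mul_eq (η n) hfi hψ hC, convolution_def]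
  simp

end TranslationDefect

/-! ### Total variation: mollification and smooth functions -/

section TotalVariation

open scoped Convolution

variable {d : ℕ}

theorem totalVariation_congr_ae {f g : EuclideanSpace ℝ (Fin d) → ℝ} (h : f =ᵐ[volume] g) :
    totalVariation f = totalVariation g := by
  unfold totalVariation
  have h1 : ∀ φ : EuclideanSpace ℝ (Fin d) → EuclideanSpace ℝ (Fin d),
      ∫ x, f x * divergence φ x = ∫ x, g x * divergence φ x := fun φ => by
    refine integral_congr_ae ?_
    filter_upwards [h] with x hx
    rw [hx]
  simp_rw [h1]

theorem continuous_divergence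
    {φ : EuclideanSpace ℝ (Fin d) → EuclideanSpace ℝ (Fin d)} (hφ : ContDiff ℝ 1 φ) :
    Continuous (divergence φ) := by
  have := hφ.continuous_fderiv (by norm_num)
  unfold divergence
  fun_prop

theorem hasCompactSupport_divergence
    {φ : EuclideanSpace ℝ (Fin d) → EuclideanSpace ℝ (Fin d)} (hφ : HasCompactSupport φ) :
    HasCompactSupport (divergence φ) := by
  refine (hφ.fderiv ℝ).comp_left
    (g := fun A : EuclideanSpace ℝ (Fin d) →L[ℝ] EuclideanSpace ℝ (Fin d) =>
      ∑ i : Fin d, (A (EuclideanSpace.single i 1)) i) (by simp)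

theorem ofReal_integral_mul_divergence_le_totalVariation
    (f : EuclideanSpace ℝ (Fin d) → ℝ)
    {φ : EuclideanSpace ℝ (Fin d) → EuclideanSpace ℝ (Fin d)} (hφ : ContDiff ℝ ∞ φ)
    (hφc : HasCompactSupport φ) (hφ1 : ∀ x, ‖φ x‖ ≤ 1) :
    ENNReal.ofReal (∫ x, f x * divergence φ x) ≤ totalVariation f :=
  le_iSup₂_of_le (f := fun (φ : EuclideanSpace ℝ (Fin d) → EuclideanSpace ℝ (Fin d))
    (_ : ContDiff ℝ ∞ φ ∧ HasCompactSupport φ ∧ ∀ x, ‖φ x‖ ≤ 1) =>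
    ENNReal.ofReal (∫ x, f x * divergence φ x)) φ ⟨hφ, hφc, hφ1⟩ le_rfl

/-- Mollification does not increase the total variation. -/
theorem totalVariation_convolution_le (η : ContDiffBump (0 : EuclideanSpace ℝ (Fin d)))
    {f : EuclideanSpace ℝ (Fin d) → ℝ} (hfi : Integrable f) :
    totalVariation (η.normed volume ⋆[ContinuousLinearMap.lsmul ℝ ℝ, volume] f)
      ≤ totalVariation f := by
  rcases eq_or_ne (totalVariation f) ⊤ with htop | htop
  · simp [htop]
  refine iSup₂_le fun φ hφ => ?_
  obtain ⟨hφ, hφc, hφ1⟩ := hφ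
  have hcont := continuous_divergence (hφ.of_le (by simp))
  obtain ⟨C, hC⟩ := (hasCompactSupport_divergence hφc).exists_bound_of_continuous hcont
  rw [integral_convolution_mul_eq η hfi hcont hC]
  have hηi : Integrable (η.normed volume) :=
    η.continuous_normed.integrable_of_hasCompactSupport η.hasCompactSupport_normed
  -- A translate of an admissible field is admissible, so an average over translates stays below the
  -- supremum.
  have hle : ∀ t, ∫ x, f x * divergence φ (x + t) ≤ (totalVariation f).toReal := by
    intro t
    have h1 : ∀ x, divergence φ (x + t) = divergence (fun x => φ (x + t)) x := by
      intro x
      simp only [divergence, fderiv_comp_add_right]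
    simp_rw [h1]
    rw [← ENNReal.ofReal_le_iff_le_toReal htop]
    exact ofReal_integral_mul_divergence_le_totalVariation f (by fun_prop)
      (hφc.comp_homeomorph (Homeomorph.addRight t)) fun x => hφ1 _
  rw [ENNReal.ofReal_le_iff_le_toReal htop]
  calc ∫ t, η.normed volume t * ∫ x, f x * divergence φ (x + t)
      ≤ ∫ t, η.normed volume t * (totalVariation f).toReal := by
        refine integral_mono ?_ (hηi.mul_const _) fun t =>
          mul_le_mul_of_nonneg_left (hle t) (η.nonneg_normed _)
        have hT := (continuous_integral_mul_comp_sub hfi hcont hC).comp continuous_neg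
        simp only [Function.comp_def, sub_neg_eq_add] at hT
        exact (η.continuous_normed.mul hT).integrable_of_hasCompactSupport
          η.hasCompactSupport_normed.mul_right
    _ = (totalVariation f).toReal := by
      rw [integral_mul_const, η.integral_normed, one_mul]

/-- Integration by parts in each coordinate; the compact support of `φ` alone makes every product
integrable. -/
theorem integral_mul_divergence_eq_neg {u : EuclideanSpace ℝ (Fin d) → ℝ} (hu : ContDiff ℝ 1 u)
    {φ : EuclideanSpace ℝ (Fin d) → EuclideanSpace ℝ (Fin d)} (hφ : ContDiff ℝ 1 φ)
    (hφc : HasCompactSupport φ) :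
    ∫ x, u x * divergence φ x = -∫ x, fderiv ℝ u x (φ x) := by
  have hu' := hu.continuous_fderiv (by norm_num)
  have hφ' := hφ.continuous_fderiv (by norm_num)
  have hcu := hu.continuous
  have hcφ := hφ.continuous
  have hcoord : ∀ i, ContDiff ℝ 1 fun x => φ x i := fun i => by fun_prop
  have hcc : ∀ i, HasCompactSupport fun x => φ x i := fun i =>
    hφc.comp_left (g := fun v : EuclideanSpace ℝ (Fin d) => v i) (by simp)
  have hfd : ∀ i x v, (fderiv ℝ φ x v) i = fderiv ℝ (fun x => φ x i) x v := by
    intro i x v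
    have h1 : HasFDerivAt (fun x => φ x i)
        ((EuclideanSpace.proj i : EuclideanSpace ℝ (Fin d) →L[ℝ] ℝ).comp (fderiv ℝ φ x)) x :=
      (EuclideanSpace.proj i : EuclideanSpace ℝ (Fin d) →L[ℝ] ℝ).hasFDerivAt.comp x
        ((hφ.differentiable (by norm_num)) x).hasFDerivAt
    rw [h1.fderiv]
    simp
  have hi1 : ∀ i, Integrable fun x => fderiv ℝ u x (EuclideanSpace.single i 1) * φ x i := fun i =>
    Continuous.integrable_of_hasCompactSupport (by fun_prop) (hcc i).mul_left
  have hi2 : ∀ i, Integrable fun x =>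
      u x * fderiv ℝ (fun x => φ x i) x (EuclideanSpace.single i 1) := fun i => by
    have := (hcoord i).continuous_fderiv (by norm_num)
    exact Continuous.integrable_of_hasCompactSupport (by fun_prop)
      ((hcc i).fderiv_apply ℝ _).mul_left
  have hi3 : ∀ i, Integrable fun x => u x * φ x i := fun i =>
    Continuous.integrable_of_hasCompactSupport (by fun_prop) (hcc i).mul_left
  have hsum : ∀ x, fderiv ℝ u x (φ x)
      = ∑ i, fderiv ℝ u x (EuclideanSpace.single i 1) * φ x i := by
    intro x
    conv_lhs => rw [← (EuclideanSpace.basisFun (Fin d) ℝ).sum_repr (φ x)]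
    simp [mul_comm]
  simp_rw [hsum, divergence, Finset.mul_sum, hfd]
  rw [integral_finsetSum _ fun i _ => hi2 i, integral_finsetSum _ fun i _ => hi1 i,
    ← Finset.sum_neg_distrib]
  refine Finset.sum_congr rfl fun i _ => ?_
  exact integral_mul_fderiv_eq_neg_fderiv_mul_of_integrable (hi1 i) (hi2 i) (hi3 i)
    (fun x _ => (hu.differentiable (by norm_num)) x)
    (fun x _ => ((hcoord i).differentiable (by norm_num)) x)

/-- Testing a `C¹` function gives at most the `L¹` norm of its derivative. -/
theorem totalVariation_le_lintegral_fderiv {u : EuclideanSpace ℝ (Fin d) → ℝ}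
    (hu : ContDiff ℝ 1 u) : totalVariation u ≤ ∫⁻ x, ‖fderiv ℝ u x‖ₑ := by
  refine iSup₂_le fun φ hφ => ?_
  obtain ⟨hφ, hφc, hφ1⟩ := hφ
  rw [integral_mul_divergence_eq_neg hu (hφ.of_le (by simp)) hφc, ← integral_neg]
  calc ENNReal.ofReal (∫ x, -fderiv ℝ u x (φ x))
      ≤ ‖∫ x, -fderiv ℝ u x (φ x)‖ₑ := Real.ofReal_le_enorm _
    _ ≤ ∫⁻ x, ‖-fderiv ℝ u x (φ x)‖ₑ := enorm_integral_le_lintegral_enorm _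
    _ ≤ ∫⁻ x, ‖fderiv ℝ u x‖ₑ := by
      refine lintegral_mono fun x => ?_
      rw [enorm_neg, ← ofReal_norm, ← ofReal_norm]
      exact ENNReal.ofReal_le_ofReal ((fderiv ℝ u x).le_of_opNorm_le_of_le le_rfl (hφ1 x) |>.trans
        (by simp))

/-- For a smooth function with compact support, the `L¹` norm of the derivative is at most the
total variation. -/
theorem lintegral_fderiv_le_totalVariation {u : EuclideanSpace ℝ (Fin d) → ℝ}
    (hu : ContDiff ℝ ∞ u) (huc : HasCompactSupport u) :
    ∫⁻ x, ‖fderiv ℝ u x‖ₑ ≤ totalVariation u := by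
  let G : EuclideanSpace ℝ (Fin d) → EuclideanSpace ℝ (Fin d) := fun x =>
    (InnerProductSpace.toDual ℝ _).symm (fderiv ℝ u x)
  have hGn : ∀ x, ‖G x‖ = ‖fderiv ℝ u x‖ := fun x => LinearIsometryEquiv.norm_map _ _
  have hGi : ∀ x v, fderiv ℝ u x v = inner ℝ (G x) v := fun x v => by
    simp [G]
  have hG : ContDiff ℝ ∞ G :=
    (InnerProductSpace.toDual ℝ _).symm.contDiff.comp (hu.fderiv_right (by simp))
  have hGc : HasCompactSupport G := (huc.fderiv ℝ).comp_left
    (g := (InnerProductSpace.toDual ℝ (EuclideanSpace ℝ (Fin d))).symm) (by simp)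
  have hGcont := hG.continuous
  have key : ∀ δ > 0, ∫⁻ x, ENNReal.ofReal (‖G x‖ ^ 2 / √(‖G x‖ ^ 2 + δ ^ 2))
      ≤ totalVariation u := by
    intro δ hδ
    have hpos : ∀ x, 0 < ‖G x‖ ^ 2 + δ ^ 2 := fun x => by positivity
    -- The optimal field -∇u/|∇u| is singular where ∇u = 0. The regularisation by δ keeps it smooth
    -- and of norm at most 1, and Fatou removes δ at the end.
    let φ : EuclideanSpace ℝ (Fin d) → EuclideanSpace ℝ (Fin d) := fun x =>
      (-(√(‖G x‖ ^ 2 + δ ^ 2))⁻¹) • G x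
    have hφ : ContDiff ℝ ∞ φ := by
      refine ContDiff.smul (ContDiff.neg (ContDiff.inv (ContDiff.sqrt ?_ ?_) ?_)) hG
      · exact (hG.norm_sq ℝ).add contDiff_const
      · exact fun x => (hpos x).ne'
      · exact fun x => (Real.sqrt_pos.2 (hpos x)).ne'
    have hφc : HasCompactSupport φ :=
      hGc.comp_left (g := fun v => (-(√(‖v‖ ^ 2 + δ ^ 2))⁻¹) • v) (by simp)
    have hφ1 : ∀ x, ‖φ x‖ ≤ 1 := by
      intro x
      have hs := Real.sqrt_pos.2 (hpos x)
      rw [norm_smul, norm_neg, norm_inv, Real.norm_of_nonneg hs.le, inv_mul_le_one₀ hs]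
      exact Real.le_sqrt_of_sq_le (by nlinarith)
    have hval : ∀ x, fderiv ℝ u x (φ x) = -(‖G x‖ ^ 2 / √(‖G x‖ ^ 2 + δ ^ 2)) := by
      intro x
      rw [hGi, inner_smul_right, real_inner_self_eq_norm_sq]
      ring
    have h := ofReal_integral_mul_divergence_le_totalVariation u hφ hφc hφ1
    rw [integral_mul_divergence_eq_neg (hu.of_le (by simp)) (hφ.of_le (by simp)) hφc,
      ← integral_neg] at h
    simp_rw [hval, neg_neg] at h
    rwa [ofReal_integral_eq_lintegral_ofReal] at h
    · refine Continuous.integrable_of_hasCompactSupport ?_ ?_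
      · refine Continuous.div (by fun_prop) (by fun_prop) fun x => (Real.sqrt_pos.2 (hpos x)).ne'
      · exact hGc.comp_left (g := fun v => ‖v‖ ^ 2 / √(‖v‖ ^ 2 + δ ^ 2)) (by simp)
    · exact .of_forall fun x => by positivity
  have hlim : ∀ x, Tendsto (fun δ : ℝ => ENNReal.ofReal (‖G x‖ ^ 2 / √(‖G x‖ ^ 2 + δ ^ 2)))
      (𝓝[>] 0) (𝓝 ‖fderiv ℝ u x‖ₑ) := by
    intro x
    rw [← ofReal_norm, ← hGn]
    refine ENNReal.tendsto_ofReal ?_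
    rcases eq_or_ne (‖G x‖) 0 with h0 | h0
    · simp [h0]
    · have hc : ContinuousAt (fun δ : ℝ => ‖G x‖ ^ 2 / √(‖G x‖ ^ 2 + δ ^ 2)) 0 := by
        refine ContinuousAt.div (by fun_prop) (by fun_prop) ?_
        simpa using h0
      have := hc.tendsto.mono_left (nhdsWithin_le_nhds (s := Ioi 0))
      convert this using 2
      simp only [ne_eq, OfNat.ofNat_ne_zero, not_false_eq_true, zero_pow, add_zero]
      rw [Real.sqrt_sq (norm_nonneg _)]
      field_simp
  calc ∫⁻ x, ‖fderiv ℝ u x‖ₑ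
      = ∫⁻ x, liminf (fun δ : ℝ => ENNReal.ofReal (‖G x‖ ^ 2 / √(‖G x‖ ^ 2 + δ ^ 2))) (𝓝[>] 0) :=
        lintegral_congr fun x => (hlim x).liminf_eq.symm
    _ ≤ liminf (fun δ : ℝ => ∫⁻ x, ENNReal.ofReal (‖G x‖ ^ 2 / √(‖G x‖ ^ 2 + δ ^ 2))) (𝓝[>] 0) :=
        lintegral_liminf_le fun δ => by fun_prop
    _ ≤ totalVariation u := by
      refine liminf_le_of_frequently_le' (Eventually.frequently ?_)
      filter_upwards [self_mem_nhdsWithin] with δ hδ using key δ hδ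

end TotalVariation

/-! ### Spherical means of the L¹ distances to translates -/

section SphericalMeans

open scoped Convolution

variable {d : ℕ}

/-- The bounded ratio of the radii is what almost everywhere convergence of mollifications, by
Lebesgue differentiation, requires. -/
theorem exists_contDiffBump_seq (E : Type*) [NormedAddCommGroup E] [NormedSpace ℝ E] :
    ∃ η : ℕ → ContDiffBump (0 : E), Tendsto (fun n => (η n).rOut) atTop (𝓝 0) ∧
      ∀ n, (η n).rOut ≤ 2 * (η n).rIn := by
  refine ⟨fun n => ⟨1 / ((n : ℝ) + 1), 2 * (1 / ((n : ℝ) + 1)), by positivity, ?_⟩, ?_,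
    fun n => le_rfl⟩
  · have : 0 < 1 / ((n : ℝ) + 1) := by positivity
    linarith
  · simpa using (tendsto_one_div_add_atTop_nhds_zero_nat (𝕜 := ℝ)).const_mul 2

/-- Tonelli puts the spherical integral inside, where it acts on the gradient vector at each point
x. -/
theorem lintegral_toSphere_lintegral_fderiv (hd : 1 ≤ d) {e : EuclideanSpace ℝ (Fin d)}
    (he : ‖e‖ = 1) {u : EuclideanSpace ℝ (Fin d) → ℝ} (hu : ContDiff ℝ 1 u) :
    ∫⁻ ξ : Metric.sphere (0 : EuclideanSpace ℝ (Fin d)) 1, ∫⁻ x,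
      ‖fderiv ℝ u x (ξ : EuclideanSpace ℝ (Fin d))‖ₑ ∂volume ∂(volume : Measure _).toSphere =
    ENNReal.ofReal (sphereMean e) *
      (volume : Measure (EuclideanSpace ℝ (Fin d))).toSphere univ * ∫⁻ x, ‖fderiv ℝ u x‖ₑ := by
  have hc := hu.continuous_fderiv (by norm_num)
  rw [lintegral_lintegral_swap, ← lintegral_const_mul _ (by fun_prop)]
  · refine lintegral_congr fun x => ?_
    have h := lintegral_toSphere_abs_inner hd he
      ((InnerProductSpace.toDual ℝ _).symm (fderiv ℝ u x))
    simp only [InnerProductSpace.toDual_symm_apply] at h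
    rw [h, mul_comm, ← ofReal_norm, LinearIsometryEquiv.norm_map, ofReal_norm]
  · refine Continuous.aemeasurable ?_
    exact ((hc.comp continuous_snd).clm_apply (continuous_subtype_val.comp continuous_fst)).enorm

/-- The spherical means of the `L¹` distances to translates are bounded by the total variation. -/
theorem lintegral_toSphere_translationDefect_le (hd : 1 ≤ d) {e : EuclideanSpace ℝ (Fin d)}
    (he : ‖e‖ = 1) {f : EuclideanSpace ℝ (Fin d) → ℝ} (hfi : Integrable f)
    (hfc : HasCompactSupport f) {r : ℝ} (hr : 0 < r) :
    ∫⁻ ξ : Metric.sphere (0 : EuclideanSpace ℝ (Fin d)) 1,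
      translationDefect volume f (r • (ξ : EuclideanSpace ℝ (Fin d)))
        ∂(volume : Measure _).toSphere ≤
    ENNReal.ofReal r * (ENNReal.ofReal (sphereMean e) *
      (volume : Measure (EuclideanSpace ℝ (Fin d))).toSphere univ * totalVariation f) := by
  obtain ⟨η, hη, hη2⟩ := exists_contDiffBump_seq (EuclideanSpace ℝ (Fin d))
  let u : ℕ → EuclideanSpace ℝ (Fin d) → ℝ := fun n =>
    (η n).normed volume ⋆[ContinuousLinearMap.lsmul ℝ ℝ, volume] f
  have hu : ∀ n, ContDiff ℝ ∞ (u n) := fun n =>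
    (η n).hasCompactSupport_normed.contDiff_convolution_left _ (η n).contDiff_normed
      hfi.locallyIntegrable
  have huc : ∀ n, HasCompactSupport (u n) := fun n =>
    (η n).hasCompactSupport_normed.convolution _ hfc
  have hlim : ∀ᵐ x, Tendsto (fun n => u n x) atTop (𝓝 (f x)) :=
    ContDiffBump.ae_convolution_tendsto_right_of_locallyIntegrable hη
      (.of_forall hη2) hfi.locallyIntegrable
  have hmeas : ∀ n, Measurable (u n) := fun n => (hu n).continuous.measurable
  -- Along an almost everywhere convergent sequence the L¹ distance to a translate is lower
  -- semicontinuous.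
  have hfatou : ∀ h, translationDefect volume f h
      ≤ liminf (fun n => translationDefect volume (u n) h) atTop := by
    intro h
    have hlim' : ∀ᵐ x, Tendsto (fun n => u n (x + h)) atTop (𝓝 (f (x + h))) :=
      (measurePreserving_add_right volume h).quasiMeasurePreserving.ae hlim
    calc translationDefect volume f h
        = ∫⁻ x, liminf (fun n => ‖u n (x + h) - u n x‖ₑ) atTop := by
          refine lintegral_congr_ae ?_
          filter_upwards [hlim, hlim'] with x hx hx'
          exact (hx'.sub hx).enorm.liminf_eq.symm
      _ ≤ _ := lintegral_liminf_le fun n => by have := hmeas n; fun_prop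
  have hbound : ∀ n, ∫⁻ ξ : Metric.sphere (0 : EuclideanSpace ℝ (Fin d)) 1,
      translationDefect volume (u n) (r • (ξ : EuclideanSpace ℝ (Fin d)))
        ∂(volume : Measure _).toSphere ≤
      ENNReal.ofReal r * (ENNReal.ofReal (sphereMean e) *
        (volume : Measure (EuclideanSpace ℝ (Fin d))).toSphere univ * totalVariation f) := by
    intro n
    have hu1 : ContDiff ℝ 1 (u n) := (hu n).of_le (by simp)
    calc _ ≤ ∫⁻ ξ : Metric.sphere (0 : EuclideanSpace ℝ (Fin d)) 1, ENNReal.ofReal r * ∫⁻ x,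
          ‖fderiv ℝ (u n) x (ξ : EuclideanSpace ℝ (Fin d))‖ₑ ∂volume
            ∂(volume : Measure _).toSphere := by
          refine lintegral_mono fun ξ => (translationDefect_le_lintegral_fderiv hu1 _).trans_eq ?_
          rw [← lintegral_const_mul' _ _ ENNReal.ofReal_ne_top]
          refine lintegral_congr fun x => ?_
          rw [map_smul, enorm_smul, Real.enorm_of_nonneg hr.le]
      _ ≤ _ := by
          rw [lintegral_const_mul' _ _ ENNReal.ofReal_ne_top,
            lintegral_toSphere_lintegral_fderiv hd he hu1]
          gcongr
          exact (lintegral_fderiv_le_totalVariation (hu n) (huc n)).trans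
            (totalVariation_convolution_le (η n) hfi)
  calc _ ≤ ∫⁻ ξ : Metric.sphere (0 : EuclideanSpace ℝ (Fin d)) 1, liminf (fun n =>
        translationDefect volume (u n) (r • (ξ : EuclideanSpace ℝ (Fin d)))) atTop
          ∂(volume : Measure _).toSphere := lintegral_mono fun ξ => hfatou _
    _ ≤ _ := lintegral_liminf_le fun n =>
      (measurable_translationDefect (hmeas n)).comp (by fun_prop)
    _ ≤ _ := liminf_le_of_frequently_le' (.of_forall hbound)

/-- The difference quotients converge pointwise to directional derivatives; Fatou is applied in x
and then on the sphere, so no domination is needed. -/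
theorem le_liminf_lintegral_toSphere_translationDefect_of_contDiff (hd : 1 ≤ d)
    {e : EuclideanSpace ℝ (Fin d)} (he : ‖e‖ = 1) {u : EuclideanSpace ℝ (Fin d) → ℝ}
    (hu : ContDiff ℝ 1 u) :
    ENNReal.ofReal (sphereMean e) *
      (volume : Measure (EuclideanSpace ℝ (Fin d))).toSphere univ * ∫⁻ x, ‖fderiv ℝ u x‖ₑ ≤
    liminf (fun r : ℝ => ‖r‖ₑ⁻¹ * ∫⁻ ξ : Metric.sphere (0 : EuclideanSpace ℝ (Fin d)) 1,
      translationDefect volume u (r • (ξ : EuclideanSpace ℝ (Fin d)))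
        ∂(volume : Measure _).toSphere) (𝓝[>] 0) := by
  have hm : Measurable u := hu.continuous.measurable
  rw [← lintegral_toSphere_lintegral_fderiv hd he hu]
  have hlim : ∀ x v : EuclideanSpace ℝ (Fin d), ‖fderiv ℝ u x v‖ₑ =
      liminf (fun r : ℝ => ‖r‖ₑ⁻¹ * ‖u (x + r • v) - u x‖ₑ) (𝓝[>] 0) := by
    intro x v
    have h1 := (((hu.differentiable (by norm_num)) x).hasFDerivAt.hasLineDerivAt
      v).tendsto_slope_zero_right.enorm
    refine (Tendsto.liminf_eq (h1.congr' ?_)).symm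
    filter_upwards [self_mem_nhdsWithin] with r hr
    rw [enorm_smul, enorm_inv (ne_of_gt hr)]
  calc ∫⁻ ξ : Metric.sphere (0 : EuclideanSpace ℝ (Fin d)) 1, ∫⁻ x,
        ‖fderiv ℝ u x (ξ : EuclideanSpace ℝ (Fin d))‖ₑ ∂volume ∂(volume : Measure _).toSphere
      ≤ ∫⁻ ξ : Metric.sphere (0 : EuclideanSpace ℝ (Fin d)) 1, liminf (fun r : ℝ => ∫⁻ x,
        ‖r‖ₑ⁻¹ * ‖u (x + r • (ξ : EuclideanSpace ℝ (Fin d))) - u x‖ₑ) (𝓝[>] 0)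
          ∂(volume : Measure _).toSphere := by
        refine lintegral_mono fun ξ => ?_
        simp_rw [hlim]
        exact lintegral_liminf_le fun r => by fun_prop
    _ ≤ liminf (fun r : ℝ => ∫⁻ ξ : Metric.sphere (0 : EuclideanSpace ℝ (Fin d)) 1, ∫⁻ x,
        ‖r‖ₑ⁻¹ * ‖u (x + r • (ξ : EuclideanSpace ℝ (Fin d))) - u x‖ₑ
          ∂volume ∂(volume : Measure _).toSphere) (𝓝[>] 0) :=
        lintegral_liminf_le fun r => Measurable.lintegral_prod_right (by fun_prop)
    _ = _ := by
      refine liminf_congr ?_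
      filter_upwards [self_mem_nhdsWithin] with r hr
      have hr' : ‖r‖ₑ⁻¹ ≠ ⊤ := by simpa using ne_of_gt hr
      simp_rw [lintegral_const_mul' _ _ hr']
      rfl

/-- The spherical means of the `L¹` distances to translates recover the total variation. -/
theorem le_liminf_lintegral_toSphere_translationDefect (hd : 1 ≤ d)
    {e : EuclideanSpace ℝ (Fin d)} (he : ‖e‖ = 1) {f : EuclideanSpace ℝ (Fin d) → ℝ}
    (hf : Measurable f) (hfi : Integrable f) :
    ENNReal.ofReal (sphereMean e) *
      (volume : Measure (EuclideanSpace ℝ (Fin d))).toSphere univ * totalVariation f ≤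
    liminf (fun r : ℝ => ‖r‖ₑ⁻¹ * ∫⁻ ξ : Metric.sphere (0 : EuclideanSpace ℝ (Fin d)) 1,
      translationDefect volume f (r • (ξ : EuclideanSpace ℝ (Fin d)))
        ∂(volume : Measure _).toSphere) (𝓝[>] 0) := by
  obtain ⟨η, hη, hη2⟩ := exists_contDiffBump_seq (EuclideanSpace ℝ (Fin d))
  let u : ℕ → EuclideanSpace ℝ (Fin d) → ℝ := fun n =>
    (η n).normed volume ⋆[ContinuousLinearMap.lsmul ℝ ℝ, volume] f
  have hu : ∀ n, ContDiff ℝ 1 (u n) := fun n =>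
    (η n).hasCompactSupport_normed.contDiff_convolution_left _ (η n).contDiff_normed
      hfi.locallyIntegrable
  -- For a fixed test field the integral passes to the limit, so the total variation is at most the
  -- supremum over the mollifications.
  have htv : totalVariation f ≤ ⨆ n, totalVariation (u n) := by
    refine iSup₂_le fun φ hφ => ?_
    obtain ⟨hφ, hφc, hφ1⟩ := hφ
    have hcont := continuous_divergence (hφ.of_le (by simp))
    obtain ⟨C, hC⟩ := (hasCompactSupport_divergence hφc).exists_bound_of_continuous hcont
    refine le_of_tendsto (ENNReal.tendsto_ofReal
      (tendsto_integral_convolution_mul hη hfi hcont hC)) (.of_forall fun n => ?_)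
    exact (ofReal_integral_mul_divergence_le_totalVariation (u n) hφ hφc hφ1).trans
      (le_iSup (fun n => totalVariation (u n)) n)
  refine (mul_le_mul_right htv _).trans ?_
  rw [ENNReal.mul_iSup]
  refine iSup_le fun n => ?_
  calc _ ≤ _ := mul_le_mul_right (totalVariation_le_lintegral_fderiv (hu n)) _
    _ ≤ _ := le_liminf_lintegral_toSphere_translationDefect_of_contDiff hd he (hu n)
    _ ≤ _ := by
      refine liminf_le_liminf (.of_forall fun r => ?_)
      gcongr
      exact translationDefect_convolution_le (η n) hf hfi _

end SphericalMeans

/-! ### Radial kernels and the change of variables -/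

section RadialKernels

variable {E : Type*} [NormedAddCommGroup E] [NormedSpace ℝ E] [MeasurableSpace E] [BorelSpace E]
  [FiniteDimensional ℝ E] [Nontrivial E] {μ : Measure E} [μ.IsAddHaarMeasure]

theorem aemeasurable_comp_norm {ρ : ℝ → ℝ} (hρ : AEMeasurable ρ (volume.restrict (Ioi 0))) :
    AEMeasurable (fun x : E => ρ ‖x‖) μ :=
  ⟨fun x => hρ.mk ρ ‖x‖, hρ.measurable_mk.comp measurable_norm, ae_norm_of_ae_Ioi μ hρ.ae_eq_mk⟩

/-- A radial kernel on a ball against a function, in polar coordinates. -/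
theorem setLIntegral_norm_lt_radial_mul {ρ : ℝ → ℝ≥0∞} (hρ : Measurable ρ) {k : E → ℝ≥0∞}
    (hk : Measurable k) (R : ℝ) :
    ∫⁻ x in {x : E | ‖x‖ < R}, ρ ‖x‖ * k x ∂μ =
      ∫⁻ r : Ioi (0 : ℝ), (Iio R).indicator ρ r * ∫⁻ ξ, k (r.1 • (ξ : E)) ∂μ.toSphere
        ∂Measure.volumeIoiPow (Module.finrank ℝ E - 1) := by
  have hS : MeasurableSet {x : E | ‖x‖ < R} := measurableSet_lt measurable_norm measurable_const
  rw [← lintegral_indicator hS, lintegral_eq_lintegral_Ioi_lintegral_sphere μ (by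
    exact ((hρ.comp measurable_norm).mul hk).indicator hS)]
  refine lintegral_congr fun r => ?_
  have hr0 : 0 < r.1 := r.2
  have hk' : Measurable fun ξ : Metric.sphere (0 : E) 1 => k (r.1 • (ξ : E)) := by fun_prop
  rw [← lintegral_const_mul _ hk']
  refine lintegral_congr fun ξ => ?_
  by_cases hr : r.1 < R <;> simp [indicator, norm_smul, abs_of_pos hr0, hr]

theorem setLIntegral_norm_lt_radial {ρ : ℝ → ℝ≥0∞} (hρ : Measurable ρ) (c : ℝ≥0∞) (R : ℝ) :
    c * ∫⁻ x in {x : E | ‖x‖ < R}, ρ ‖x‖ ∂μ =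
      ∫⁻ r : Ioi (0 : ℝ), (Iio R).indicator ρ r * (c * μ.toSphere univ)
        ∂Measure.volumeIoiPow (Module.finrank ℝ E - 1) := by
  rw [← lintegral_const_mul _ (by fun_prop)]
  simp_rw [mul_comm c (ρ _)]
  rw [setLIntegral_norm_lt_radial_mul hρ measurable_const R]
  simp only [lintegral_const]

/-- Both sides are radial integrals with the same weight, so a bound on the spherical means of `k`
passes to the integrals. As `ρ` is only almost everywhere measurable on the half line, a measurable
version replaces it first. -/
theorem setLIntegral_norm_lt_radial_mul_le {ρ : ℝ → ℝ}
    (hρ : AEMeasurable ρ (volume.restrict (Ioi 0))) {k : E → ℝ≥0∞} (hk : Measurable k) {c : ℝ≥0∞}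
    {R : ℝ} (h : ∀ r > 0, r < R → ∫⁻ ξ, k (r • (ξ : E)) ∂μ.toSphere ≤ c * μ.toSphere univ) :
    ∫⁻ x in {x : E | ‖x‖ < R}, ENNReal.ofReal (ρ ‖x‖) * k x ∂μ ≤
      c * ∫⁻ x in {x : E | ‖x‖ < R}, ENNReal.ofReal (ρ ‖x‖) ∂μ := by
  have hae : ∀ᵐ x ∂μ, ρ ‖x‖ = hρ.mk ρ ‖x‖ := ae_norm_of_ae_Ioi μ hρ.ae_eq_mk
  have hm : Measurable fun r => ENNReal.ofReal (hρ.mk ρ r) := hρ.measurable_mk.ennreal_ofReal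
  have h1 : ∫⁻ x in {x : E | ‖x‖ < R}, ENNReal.ofReal (ρ ‖x‖) ∂μ =
      ∫⁻ x in {x : E | ‖x‖ < R}, ENNReal.ofReal (hρ.mk ρ ‖x‖) ∂μ :=
    lintegral_congr_ae (ae_restrict_of_ae (hae.mono fun x hx => by beta_reduce; rw [hx]))
  have h2 : ∫⁻ x in {x : E | ‖x‖ < R}, ENNReal.ofReal (ρ ‖x‖) * k x ∂μ =
      ∫⁻ x in {x : E | ‖x‖ < R}, ENNReal.ofReal (hρ.mk ρ ‖x‖) * k x ∂μ :=
    lintegral_congr_ae (ae_restrict_of_ae (hae.mono fun x hx => by beta_reduce; rw [hx]))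
  rw [h1, h2, setLIntegral_norm_lt_radial hm, setLIntegral_norm_lt_radial_mul hm hk]
  refine lintegral_mono fun r => ?_
  by_cases hr : r.1 < R
  · exact mul_le_mul_right (h r r.2 hr) _
  · simp [indicator, hr]

theorem le_setLIntegral_norm_lt_radial_mul {ρ : ℝ → ℝ}
    (hρ : AEMeasurable ρ (volume.restrict (Ioi 0))) {k : E → ℝ≥0∞} (hk : Measurable k) {c : ℝ≥0∞}
    {R : ℝ} (h : ∀ r > 0, r < R → c * μ.toSphere univ ≤ ∫⁻ ξ, k (r • (ξ : E)) ∂μ.toSphere) :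
    c * ∫⁻ x in {x : E | ‖x‖ < R}, ENNReal.ofReal (ρ ‖x‖) ∂μ ≤
      ∫⁻ x in {x : E | ‖x‖ < R}, ENNReal.ofReal (ρ ‖x‖) * k x ∂μ := by
  have hae : ∀ᵐ x ∂μ, ρ ‖x‖ = hρ.mk ρ ‖x‖ := ae_norm_of_ae_Ioi μ hρ.ae_eq_mk
  have hm : Measurable fun r => ENNReal.ofReal (hρ.mk ρ r) := hρ.measurable_mk.ennreal_ofReal
  have h1 : ∫⁻ x in {x : E | ‖x‖ < R}, ENNReal.ofReal (ρ ‖x‖) ∂μ =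
      ∫⁻ x in {x : E | ‖x‖ < R}, ENNReal.ofReal (hρ.mk ρ ‖x‖) ∂μ :=
    lintegral_congr_ae (ae_restrict_of_ae (hae.mono fun x hx => by beta_reduce; rw [hx]))
  have h2 : ∫⁻ x in {x : E | ‖x‖ < R}, ENNReal.ofReal (ρ ‖x‖) * k x ∂μ =
      ∫⁻ x in {x : E | ‖x‖ < R}, ENNReal.ofReal (hρ.mk ρ ‖x‖) * k x ∂μ :=
    lintegral_congr_ae (ae_restrict_of_ae (hae.mono fun x hx => by beta_reduce; rw [hx]))
  rw [h1, h2, setLIntegral_norm_lt_radial hm, setLIntegral_norm_lt_radial_mul hm hk]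
  refine lintegral_mono fun r => ?_
  by_cases hr : r.1 < R
  · exact mul_le_mul_right (h r r.2 hr) _
  · simp [indicator, hr]

/-- The double integral as an integral of the `L¹` distances to translates. -/
theorem lintegral_lintegral_difference_quotient_eq {f g : E → ℝ} (hfg : f =ᵐ[μ] g)
    (hg : Measurable g) {ρ : ℝ → ℝ} (hρ : AEMeasurable ρ (volume.restrict (Ioi 0))) :
    ∫⁻ x, ∫⁻ y, ENNReal.ofReal (|f x - f y| / ‖x - y‖ * ρ ‖x - y‖) ∂μ ∂μ =
      ∫⁻ h, ENNReal.ofReal (ρ ‖h‖) * (‖h‖ₑ⁻¹ * translationDefect μ g h) ∂μ := by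
  -- Off the origin `‖h‖ₑ⁻¹` is finite, so it can be pulled out of the inner integral.
  have h0 : ∀ᵐ h : E ∂μ, h ≠ 0 := by
    rw [ae_iff]
    simp
  have hρE : AEMeasurable (fun h : E => ENNReal.ofReal (ρ ‖h‖)) μ :=
    (aemeasurable_comp_norm hρ).ennreal_ofReal
  have hinner : ∀ᵐ x ∂μ, ∫⁻ y, ENNReal.ofReal (|f x - f y| / ‖x - y‖ * ρ ‖x - y‖) ∂μ =
      ∫⁻ h, ENNReal.ofReal (ρ ‖h‖) * (‖h‖ₑ⁻¹ * ‖g (x + h) - g x‖ₑ) ∂μ := by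
    filter_upwards [hfg] with x hx
    have hx' : ∀ᵐ h ∂μ, f (x + h) = g (x + h) :=
      (measurePreserving_add_left μ x).quasiMeasurePreserving.ae hfg
    rw [← lintegral_add_left_eq_self _ x]
    refine lintegral_congr_ae ?_
    filter_upwards [hx', h0] with h hh hne
    have hn : 0 < ‖h‖ := norm_pos_iff.2 hne
    have hxh : ‖x - (x + h)‖ = ‖h‖ := by simp
    rw [hxh, hx, hh, ENNReal.ofReal_mul (by positivity), ENNReal.ofReal_div_of_pos hn, abs_sub_comm,
      ← Real.norm_eq_abs, ofReal_norm, ofReal_norm, div_eq_mul_inv, mul_comm, mul_comm ‖_‖ₑ]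
  rw [lintegral_congr_ae hinner, lintegral_lintegral_swap]
  · refine lintegral_congr_ae ?_
    filter_upwards [h0] with h hne
    have h1 : ‖h‖ₑ⁻¹ ≠ ⊤ := by simpa using hne
    rw [lintegral_const_mul' _ _ ENNReal.ofReal_ne_top, lintegral_const_mul' _ _ h1,
      translationDefect]
  · exact (hρE.comp_quasiMeasurePreserving Measure.quasiMeasurePreserving_snd).mul
      (Measurable.aemeasurable (by fun_prop))

end RadialKernels

/-! ### A good representative, and the limit -/

theorem MemBV.exists_measurable_hasCompactSupport_ae_eq {d : ℕ}
    {f : EuclideanSpace ℝ (Fin d) → ℝ} (hf : MemBV f)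
    (hsupp : ∃ K : Set (EuclideanSpace ℝ (Fin d)), IsCompact K ∧ ∀ᵐ x, x ∉ K → f x = 0) :
    ∃ g : EuclideanSpace ℝ (Fin d) → ℝ, f =ᵐ[volume] g ∧ Measurable g ∧ Integrable g ∧
      HasCompactSupport g := by
  obtain ⟨K, hK, hfK⟩ := hsupp
  have hae := hf.1.aestronglyMeasurable.ae_eq_mk
  have hfg : f =ᵐ[volume] K.indicator (hf.1.aestronglyMeasurable.mk f) := by
    filter_upwards [hae, hfK] with x hx hxK
    by_cases hmem : x ∈ K
    · rw [indicator_of_mem hmem, hx]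
    · rw [indicator_of_notMem hmem, hxK hmem]
  exact ⟨_, hfg, hf.1.aestronglyMeasurable.stronglyMeasurable_mk.measurable.indicator
    hK.measurableSet, hf.1.congr hfg, HasCompactSupport.intro hK fun x hx =>
      indicator_of_notMem hx _⟩

theorem mainTheorem2 (d : ℕ) (hd : 1 ≤ d)
    (e : EuclideanSpace ℝ (Fin d)) (he : ‖e‖ = 1)
    (f : EuclideanSpace ℝ (Fin d) → ℝ)
    (hBV : MemBV f) (hbdd : MemLp f ⊤)
    (hsupp : ∃ K : Set (EuclideanSpace ℝ (Fin d)), IsCompact K ∧ ∀ᵐ x, x ∉ K → f x = 0)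
    (L₀ : ℝ) (ϱ : ℝ → ℝ → ℝ)
    (hmeas : ∀ L > L₀, AEMeasurable (ϱ L) (volume.restrict (Ioi 0)))
    (hnonneg : ∀ L > L₀, ∀ t > 0, 0 ≤ ϱ L t)
    (ha : ∀ R > 0, Tendsto
      (fun L => ∫⁻ x in {x : EuclideanSpace ℝ (Fin d) | R < ‖x‖}, ENNReal.ofReal (ϱ L ‖x‖ / ‖x‖))
      atTop (𝓝 0))
    (hb : ∀ R > 0, Tendsto
      (fun L => ∫⁻ x in {x : EuclideanSpace ℝ (Fin d) | ‖x‖ < R}, ENNReal.ofReal (ϱ L ‖x‖))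
      atTop (𝓝 1))
    (hc : ∀ R > 0, ∃ C > 0, ∀ L > L₀, ∀ t > R, |ϱ L t| ≤ C / t ^ d) :
    Tendsto
      (fun L => ∫⁻ x : EuclideanSpace ℝ (Fin d), ∫⁻ y : EuclideanSpace ℝ (Fin d),
        ENNReal.ofReal (|f x - f y| / ‖x - y‖ * ϱ L ‖x - y‖))
      atTop (𝓝 (ENNReal.ofReal (sphereMean e) * totalVariation f)) ∧
    sphereMean e =
      Real.Gamma ((d : ℝ) / 2) / (Real.sqrt Real.pi * Real.Gamma (((d : ℝ) + 1) / 2)) := by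
  refine ⟨?_, sphereMean_eq_Gamma_div hd he⟩
  have : Nonempty (Fin d) := ⟨⟨0, hd⟩⟩
  obtain ⟨g, hfg, hgm, hgi, hgc⟩ := hBV.exists_measurable_hasCompactSupport_ae_eq hsupp
  have hT : ENNReal.ofReal (sphereMean e) * totalVariation f ≠ ⊤ :=
    ENNReal.mul_ne_top ENNReal.ofReal_ne_top hBV.2.ne
  rw [totalVariation_congr_ae hfg] at hT ⊢
  set σ := (volume : Measure (EuclideanSpace ℝ (Fin d))).toSphere
  set T := totalVariation g
  set κ := ENNReal.ofReal (sphereMean e)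
  have hσ0 : σ univ ≠ 0 := by simp [σ, -Measure.toSphere_apply_univ]
  have hσtop : σ univ ≠ ⊤ := measure_ne_top _ _
  let k : EuclideanSpace ℝ (Fin d) → ℝ≥0∞ := fun h => ‖h‖ₑ⁻¹ * translationDefect volume g h
  have hk : Measurable k := measurable_enorm.inv.mul (measurable_translationDefect hgm)
  have hkr : ∀ r : ℝ, 0 < r → ∫⁻ ξ, k (r • (ξ : EuclideanSpace ℝ (Fin d))) ∂σ =
      ‖r‖ₑ⁻¹ * ∫⁻ ξ, translationDefect volume g (r • (ξ : EuclideanSpace ℝ (Fin d))) ∂σ := by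
    intro r hr
    have hr' : ‖r‖ₑ⁻¹ ≠ ⊤ := by simpa using ne_of_gt hr
    rw [← lintegral_const_mul' _ _ hr']
    refine lintegral_congr fun ξ => ?_
    have hξ : ‖(ξ : EuclideanSpace ℝ (Fin d))‖ₑ = 1 := by
      rw [← ofReal_norm, norm_eq_of_mem_sphere ξ, ENNReal.ofReal_one]
    simp only [k, enorm_smul, hξ, mul_one]
  have heq : ∀ L > L₀, ∫⁻ x, ∫⁻ y, ENNReal.ofReal (|f x - f y| / ‖x - y‖ * ϱ L ‖x - y‖) =
      ∫⁻ h, ENNReal.ofReal (ϱ L ‖h‖) * k h := fun L hL =>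
    lintegral_lintegral_difference_quotient_eq hfg hgm (hmeas L hL)
  refine tendsto_order.2 ⟨fun a haT => ?_, fun a haT => ?_⟩
  · obtain ⟨c, hac, hcT⟩ := exists_between haT
    have hlow := le_liminf_lintegral_toSphere_translationDefect hd he hgm hgi
    have hev := eventually_lt_of_lt_liminf (lt_of_lt_of_le (b := κ * σ univ * T)
      (by rw [mul_right_comm]; exact ENNReal.mul_lt_mul_left hσ0 hσtop hcT) hlow)
    obtain ⟨R, hR, hRsub⟩ := mem_nhdsGT_iff_exists_Ioo_subset.1 hev
    have hlim := ENNReal.Tendsto.const_mul (hb R hR) (.inr (hcT.ne_top) : _ ∨ c ≠ ⊤)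
    rw [mul_one] at hlim
    filter_upwards [hlim.eventually_const_lt hac, eventually_gt_atTop L₀] with L hL hL0
    rw [heq L hL0]
    refine hL.trans_le ((le_setLIntegral_norm_lt_radial_mul (hmeas L hL0) hk
      fun r hr hrR => ?_).trans (setLIntegral_le_lintegral _ _))
    rw [hkr r hr]
    exact le_of_lt (hRsub ⟨hr, hrR⟩)
  · have hN : 2 * ∫⁻ x, ‖g x‖ₑ ≠ ⊤ := ENNReal.mul_ne_top (by simp) hgi.2.ne
    have hlim := (ENNReal.Tendsto.const_mul (hb 1 one_pos) (.inr hT)).add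
      (ENNReal.Tendsto.const_mul (ha (1 / 2) (by norm_num)) (.inr hN))
    rw [mul_one, mul_zero, add_zero] at hlim
    filter_upwards [hlim.eventually_lt_const haT, eventually_gt_atTop L₀] with L hL hL0
    rw [heq L hL0]
    refine lt_of_le_of_lt ?_ hL
    -- Two overlapping regions, since both (a) and (b) use strict inequalities; for an upper bound
    -- the overlap is harmless.
    have hcover : (univ : Set (EuclideanSpace ℝ (Fin d))) ⊆
        {x | ‖x‖ < 1} ∪ {x | (1 / 2 : ℝ) < ‖x‖} := fun x _ => by
      rcases lt_or_ge ‖x‖ 1 with h | h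
      · exact .inl h
      · exact .inr (show (1 / 2 : ℝ) < ‖x‖ by linarith)
    rw [← setLIntegral_univ]
    refine (lintegral_mono_set hcover).trans ((lintegral_union_le _ _ _).trans (add_le_add ?_ ?_))
    -- The upper bound on spherical means holds at every radius, so the ball need not be small.
    · refine setLIntegral_norm_lt_radial_mul_le (hmeas L hL0) hk fun r hr _ => ?_
      rw [hkr r hr, Real.enorm_of_nonneg hr.le, mul_right_comm]
      exact ENNReal.inv_mul_le_iff (by simpa using hr) ENNReal.ofReal_ne_top |>.2
        (lintegral_toSphere_translationDefect_le hd he hgi hgc hr)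
    · rw [← lintegral_const_mul' _ _ hN]
      refine setLIntegral_mono' (measurableSet_lt measurable_const measurable_norm) fun x hx => ?_
      have hx0 : 0 < ‖x‖ := lt_trans (by norm_num) hx
      rw [ENNReal.ofReal_div_of_pos hx0, ofReal_norm, div_eq_mul_inv, ← mul_assoc, mul_comm]
      exact mul_le_mul_left (translationDefect_le g hgm x) _
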